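/- Let $(M,g)$ be a Riemannian manifold of dimension $n$ with Levi-Civita connection $D$, let $I\subseteq\mathbb{R}$ be a nonempty open interval, and let $f:M\to(0,\infty)$ and $\sigma:I\to(0,\infty)$ be smooth. Let $\bar M={}_fI\times_\sigma M$ be the doubly warped space-time, i.e. the manifold $I\times M$ with the metric $\bar g=-f^2dt^2\oplus\sigma^2 g$. A (pseudo-)Riemannian manifold is said to be of class $\mathcal{B}$ if its Ricci tensor is a Codazzi tensor, $(D_X\mathrm{Ric})(Y,Z)=(D_Y\mathrm{Ric})(X,Z)$ for all vector fields $X,Y,Z$. Put $\mathcal{F}=\frac1f H^f$, where $H^f$ is the Hessian of $f$ on $(M,g)$, and $$\sigma^\diamond=\sigma\,\Delta\sigma+(n-1)\,g_I(\nabla\sigma,\nabla\sigma),$$ where gradient and Laplacian are those of $(I,g_I)$, $g_I=-dt^2$; that is, $\sigma^\diamond=-\sigma\ddot\sigma-(n-1)\dot\sigma^2$. **Theorem.** Suppose that $\bar M$ is of class $\mathcal{B}$. Then $(M,g)$ is of class $\mathcal{B}$ if and only if $$(D_W\mathcal{F})(U,V)=(D_U\mathcal{F})(W,V)+\left(2\sigma^\diamond+(n-1)\dot\sigma^2\right)\frac{1}{f^3}W(f)\,g(U,V)-\left(2\sigma^\diamond+(n-1)\dot\sigma^2\right)\frac{1}{f^3}U(f)\,g(W,V)$$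 holds on $M$ for all vector fields $U,V,W$ on $M$ and at all times $t\in I$. -/

import Mathlib

open scoped Manifold ContDiff

set_option maxSynthPendingDepth 3

noncomputable section

namespace LocalTensor

/-! Tensor calculus on a finite-dimensional real vector space `E` (the coordinate space of a chart),
for a field `G` of symmetric nondegenerate bilinear forms (the coordinate expression of a
pseudo-Riemannian metric). -/

variable {E : Type*} [NormedAddCommGroup E] [NormedSpace ℝ E]

/-- The trilinear form of the Christoffel symbols of the first kind, multiplied by two:
`(u, v, z) ↦ ∂_u G(v, z) + ∂_v G(u, z) - ∂_z G(u, v)`. -/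
def christoffelFirst (G : E → E →L[ℝ] E →L[ℝ] ℝ) (x : E) : E →L[ℝ] E →L[ℝ] E →L[ℝ] ℝ :=
  fderiv ℝ G x + (fderiv ℝ G x).flip
    - ((ContinuousLinearMap.flipₗᵢ ℝ E E ℝ).toContinuousLinearEquiv :
        (E →L[ℝ] E →L[ℝ] ℝ) →L[ℝ] (E →L[ℝ] E →L[ℝ] ℝ)) ∘L (fderiv ℝ G x).flip

theorem christoffelFirst_apply (G : E → E →L[ℝ] E →L[ℝ] ℝ) (x u v z : E) :
    christoffelFirst G x u v z
      = fderiv ℝ G x u v z + fderiv ℝ G x v u z - fderiv ℝ G x z u v := rfl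

/-- The Christoffel symbols `Γ(u, v)` of the Levi-Civita connection of `G`: the index of
`christoffelFirst` is raised by the inverse of `G x : E → E*`. The covariant derivative of a vector
field `Y` in the direction `u` is `∂_u Y + Γ(u, Y)`. -/
def christoffel (G : E → E →L[ℝ] E →L[ℝ] ℝ) (x : E) : E →L[ℝ] E →L[ℝ] E :=
  (1 / 2 : ℝ) •
    ((ContinuousLinearMap.compL ℝ E (E →L[ℝ] ℝ) E (G x).inverse) ∘L christoffelFirst G x)

theorem christoffel_apply (G : E → E →L[ℝ] E →L[ℝ] ℝ) (x u v : E) :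
    christoffel G x u v = (1 / 2 : ℝ) • (G x).inverse (christoffelFirst G x u v) := rfl

/-- The linear map `u ↦ R(u, v) w`, where
`R(u, v) w = (∂_u Γ)(v, w) - (∂_v Γ)(u, w) + Γ(u, Γ(v, w)) - Γ(v, Γ(u, w))`
is the curvature tensor `R(u, v) = [D_u, D_v] - D_{[u, v]}`. -/
def curvature (G : E → E →L[ℝ] E →L[ℝ] ℝ) (x v w : E) : E →L[ℝ] E :=
  ((fderiv ℝ (christoffel G) x).flip v).flip w
    - (fderiv ℝ (christoffel G) x v).flip w
    + (christoffel G x).flip (christoffel G x v w)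
    - (christoffel G x v) ∘L ((christoffel G x).flip w)

theorem curvature_apply (G : E → E →L[ℝ] E →L[ℝ] ℝ) (x u v w : E) :
    curvature G x v w u
      = fderiv ℝ (christoffel G) x u v w - fderiv ℝ (christoffel G) x v u w
        + christoffel G x u (christoffel G x v w)
        - christoffel G x v (christoffel G x u w) := rfl

/-- The Ricci tensor `Ric(v, w) = trace (u ↦ R(u, v) w)`. -/
def ricci (G : E → E →L[ℝ] E →L[ℝ] ℝ) (x v w : E) : ℝ :=
  LinearMap.trace ℝ E (curvature G x v w : E →ₗ[ℝ] E)

/-- The covariant derivative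
`(D_w T)(u, v) = ∂_w (T(u, v)) - T(Γ(w, u), v) - T(u, Γ(w, v))` of a `(0, 2)` tensor field. -/
def covDeriv (G : E → E →L[ℝ] E →L[ℝ] ℝ) (T : E → E → E → ℝ) (x w u v : E) : ℝ :=
  fderiv ℝ (fun y => T y u v) x w - T x (christoffel G x w u) v - T x u (christoffel G x w v)

/-- The Hessian `H^φ(u, v) = ∂_u ∂_v φ - dφ(Γ(u, v))` of a function. -/
def hessian (G : E → E →L[ℝ] E →L[ℝ] ℝ) (φ : E → ℝ) (x : E) : E →L[ℝ] E →L[ℝ] ℝ :=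
  fderiv ℝ (fderiv ℝ φ) x
    - (ContinuousLinearMap.compL ℝ E E ℝ (fderiv ℝ φ x)) ∘L christoffel G x

/-- The gradient of a function. -/
def grad (G : E → E →L[ℝ] E →L[ℝ] ℝ) (φ : E → ℝ) (x : E) : E :=
  (G x).inverse (fderiv ℝ φ x)

/-- The Laplacian of a function: the trace of its Hessian with respect to `G`. -/
def laplacian (G : E → E →L[ℝ] E →L[ℝ] ℝ) (φ : E → ℝ) (x : E) : ℝ :=
  LinearMap.trace ℝ E (((G x).inverse ∘L hessian G φ x : E →L[ℝ] E) : E →ₗ[ℝ] E)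

/-- `φ^◇ = φ Δφ + (m - 1) G(∇φ, ∇φ)`, where `m` is the dimension of the other factor. -/
def diamond (G : E → E →L[ℝ] E →L[ℝ] ℝ) (m : ℕ) (φ : E → ℝ) (x : E) : ℝ :=
  φ x * laplacian G φ x + ((m : ℝ) - 1) * G x (grad G φ x) (grad G φ x)

/-- The tensor `𝓕 = (m / φ) H^φ`, where `m` is the dimension of the other factor. -/
def warpingTensor (G : E → E →L[ℝ] E →L[ℝ] ℝ) (m : ℕ) (φ : E → ℝ) (x u v : E) : ℝ :=
  (m : ℝ) / φ x * hessian G φ x u v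

end LocalTensor

/-- The pull-back of a bilinear form under a linear map: `(u, v) ↦ B (A u) (A v)`. -/
def pullbackForm {V W : Type*} [NormedAddCommGroup V] [NormedSpace ℝ V] [NormedAddCommGroup W]
    [NormedSpace ℝ W] (A : V →L[ℝ] W) (B : W →L[ℝ] W →L[ℝ] ℝ) : V →L[ℝ] V →L[ℝ] ℝ :=
  B.bilinearComp A A

section Manifold

variable {E : Type*} [NormedAddCommGroup E] [NormedSpace ℝ E]
  {H : Type*} [TopologicalSpace H] (I : ModelWithCorners ℝ E H)
  (M : Type*) [TopologicalSpace M] [ChartedSpace H M]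

/-- A field of bilinear forms on the tangent spaces of `M`, e.g. a (pseudo-)Riemannian metric. -/
abbrev BilinField : Type _ :=
  ∀ p : M, TangentSpace I p →L[ℝ] TangentSpace I p →L[ℝ] ℝ

variable {I M}

/-- The coordinate expression of a field of bilinear forms in a chart: its pull-back under the
inverse of the chart. -/
def inChart (g : BilinField I M) (e : OpenPartialHomeomorph M H) :
    E → E →L[ℝ] E →L[ℝ] ℝ := fun y =>
  pullbackForm (V := E) (W := E)
    (mfderiv 𝓘(ℝ, E) I (e.extend I).symm y) (g ((e.extend I).symm y))

/-- A (pseudo-)Riemannian metric is of class `𝓑` if its Ricci tensor is a Codazzi tensor,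
`(D_X Ric)(Y, Z) = (D_Y Ric)(X, Z)`. The identity of tensors is expressed by the components in
all charts of the smooth structure. -/
def IsClassB (g : BilinField I M) : Prop :=
  ∀ e ∈ IsManifold.maximalAtlas I ∞ M, ∀ y ∈ (e.extend I).target, ∀ u v w : E,
    LocalTensor.covDeriv (inChart g e) (LocalTensor.ricci (inChart g e)) y u v w
      = LocalTensor.covDeriv (inChart g e) (LocalTensor.ricci (inChart g e)) y v u w

end Manifold

section DoublyWarped

variable {E₁ : Type*} [NormedAddCommGroup E₁] [NormedSpace ℝ E₁]
  {H₁ : Type*} [TopologicalSpace H₁] {I₁ : ModelWithCorners ℝ E₁ H₁}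
  {M₁ : Type*} [TopologicalSpace M₁] [ChartedSpace H₁ M₁]
  {E₂ : Type*} [NormedAddCommGroup E₂] [NormedSpace ℝ E₂]
  {H₂ : Type*} [TopologicalSpace H₂] {I₂ : ModelWithCorners ℝ E₂ H₂}
  {M₂ : Type*} [TopologicalSpace M₂] [ChartedSpace H₂ M₂]

/-- The doubly warped product metric
`(f₂ ∘ π₂)² π₁^* g₁ + (f₁ ∘ π₁)² π₂^* g₂` on `M₁ × M₂`. -/
def doublyWarped (g₁ : BilinField I₁ M₁) (g₂ : BilinField I₂ M₂) (f₁ : M₁ → ℝ) (f₂ : M₂ → ℝ) :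
    BilinField (I₁.prod I₂) (M₁ × M₂) := fun q =>
  (f₂ q.2) ^ 2 • pullbackForm (V := E₁ × E₂) (W := E₁)
      (mfderiv (I₁.prod I₂) I₁ Prod.fst q) (g₁ q.1)
    + (f₁ q.1) ^ 2 • pullbackForm (V := E₁ × E₂) (W := E₂)
      (mfderiv (I₁.prod I₂) I₂ Prod.snd q) (g₂ q.2)

end DoublyWarped

/-- The metric `-dt²` of the real line. -/
def negDtSq : ℝ → ℝ →L[ℝ] ℝ →L[ℝ] ℝ := fun _ => -ContinuousLinearMap.mul ℝ ℝ

/-- The metric `-dt²` of an open subset `J` of the real line, `t` being the inclusion `J → ℝ`. -/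
def negDtSqOn (J : TopologicalSpace.Opens ℝ) : BilinField 𝓘(ℝ, ℝ) J := fun t =>
  pullbackForm (V := ℝ) (W := ℝ)
    (mfderiv 𝓘(ℝ, ℝ) 𝓘(ℝ, ℝ) (Subtype.val : J → ℝ) t) (negDtSq (t : ℝ))

end

section LinearAlgebra

theorem ContinuousLinearMap.isInvertible_of_ker_trivial {V : Type*} [NormedAddCommGroup V]
    [NormedSpace ℝ V] [FiniteDimensional ℝ V] (B : V →L[ℝ] V →L[ℝ] ℝ)
    (h : ∀ v, B v = 0 → v = 0) : B.IsInvertible := by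
  have hinj : Function.Injective (B : V →ₗ[ℝ] V →L[ℝ] ℝ) := by
    rw [injective_iff_map_eq_zero]
    exact h
  have hrank : Module.finrank ℝ V = Module.finrank ℝ (V →L[ℝ] ℝ) := by
    rw [← (LinearMap.toContinuousLinearMap (𝕜 := ℝ) (E := V) (F' := ℝ)).finrank_eq]
    exact (Subspace.dual_finrank_eq (K := ℝ) (V := V)).symm
  refine ⟨(LinearMap.linearEquivOfInjective _ hinj hrank).toContinuousLinearEquiv, ?_⟩
  ext v w
  rfl

theorem LinearMap.trace_real (f : ℝ →ₗ[ℝ] ℝ) : LinearMap.trace ℝ ℝ f = f 1 := by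
  have h : f = f.smulRight (1 : ℝ) := by ext; simp
  rw [h, LinearMap.trace_smulRight]
  simp

theorem LinearMap.trace_real_prod {V : Type*} [AddCommGroup V] [Module ℝ V]
    [Module.Finite ℝ V] (A : ℝ × V →ₗ[ℝ] ℝ × V) :
    LinearMap.trace ℝ (ℝ × V) A = (A (1, 0)).1
      + LinearMap.trace ℝ V (LinearMap.snd ℝ ℝ V ∘ₗ A ∘ₗ LinearMap.inr ℝ ℝ V) := by
  have h : A = (A ∘ₗ LinearMap.inl ℝ ℝ V) ∘ₗ LinearMap.fst ℝ ℝ V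
      + (A ∘ₗ LinearMap.inr ℝ ℝ V) ∘ₗ LinearMap.snd ℝ ℝ V := by
    refine LinearMap.ext fun x => ?_
    simp only [LinearMap.add_apply, LinearMap.comp_apply, ← map_add]
    simp
  conv_lhs => rw [h, map_add, LinearMap.trace_comp_comm' (LinearMap.fst ℝ ℝ V),
    LinearMap.trace_comp_comm' (LinearMap.snd ℝ ℝ V), LinearMap.trace_real]
  rfl

end LinearAlgebra

section Calculus

variable {E : Type*} [NormedAddCommGroup E] [NormedSpace ℝ E]
  {F : Type*} [NormedAddCommGroup F] [NormedSpace ℝ F]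
  {V : Type*} [NormedAddCommGroup V] [NormedSpace ℝ V]
  {W : Type*} [NormedAddCommGroup W] [NormedSpace ℝ W]

theorem fderiv_apply_apply {T : E → V →L[ℝ] W →L[ℝ] F} {x : E} (h : DifferentiableAt ℝ T x)
    (u : E) (v : V) (w : W) :
    fderiv ℝ T x u v w = fderiv ℝ (fun y => T y v w) x u := by
  have h1 : HasFDerivAt (fun y => T y v w)
      ((ContinuousLinearMap.apply ℝ F w) ∘L (ContinuousLinearMap.apply ℝ (W →L[ℝ] F) v) ∘L
        fderiv ℝ T x) x := by
    exact ((ContinuousLinearMap.apply ℝ F w).hasFDerivAt).comp x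
      (((ContinuousLinearMap.apply ℝ (W →L[ℝ] F) v).hasFDerivAt).comp x h.hasFDerivAt)
  rw [h1.fderiv]
  rfl

theorem DifferentiableAt.apply_apply {T : E → V →L[ℝ] W →L[ℝ] F} {x : E}
    (h : DifferentiableAt ℝ T x) (v : V) (w : W) :
    DifferentiableAt ℝ (fun y => T y v w) x := by
  fun_prop

theorem differentiableAt_smul_prod {a : ℝ → ℝ} {b : E → F} {p : ℝ × E}
    (ha : DifferentiableAt ℝ a p.1) (hb : DifferentiableAt ℝ b p.2) :
    DifferentiableAt ℝ (fun q : ℝ × E => a q.1 • b q.2) p :=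
  (ha.comp p differentiableAt_fst).smul (hb.comp p differentiableAt_snd)

theorem fderiv_smul_prod {a : ℝ → ℝ} {b : E → F} {p : ℝ × E}
    (ha : DifferentiableAt ℝ a p.1) (hb : DifferentiableAt ℝ b p.2) (u : ℝ × E) :
    fderiv ℝ (fun q : ℝ × E => a q.1 • b q.2) p u
      = (u.1 * deriv a p.1) • b p.2 + a p.1 • fderiv ℝ b p.2 u.2 := by
  have h1 : HasFDerivAt (fun q : ℝ × E => a q.1)
      ((fderiv ℝ a p.1) ∘L ContinuousLinearMap.fst ℝ ℝ E) p :=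
    ha.hasFDerivAt.comp p hasFDerivAt_fst
  have h2 : HasFDerivAt (fun q : ℝ × E => b q.2)
      ((fderiv ℝ b p.2) ∘L ContinuousLinearMap.snd ℝ ℝ E) p :=
    hb.hasFDerivAt.comp p hasFDerivAt_snd
  rw [show (fun q : ℝ × E => a q.1 • b q.2) = (fun q : ℝ × E => a q.1) • fun q : ℝ × E => b q.2 from rfl,
    (h1.smul h2).fderiv]
  simp [fderiv_eq_smul_deriv, add_comm]

theorem fderiv_div_apply {a b : E → ℝ} {x : E} (ha : DifferentiableAt ℝ a x)
    (hb : DifferentiableAt ℝ b x) (h0 : b x ≠ 0) (v : E) :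
    fderiv ℝ (fun y => a y / b y) x v
      = fderiv ℝ a x v / b x - a x * fderiv ℝ b x v / b x ^ 2 := by
  have h := ha.hasFDerivAt.mul ((hasDerivAt_inv h0).comp_hasFDerivAt x hb.hasFDerivAt)
  rw [show (fun y => a y / b y) = a * (fun y => y⁻¹) ∘ b from
    funext fun y => div_eq_mul_inv _ _, h.fderiv]
  simp
  field_simp
  ring

end Calculus

namespace LocalTensor

variable {E : Type*} [NormedAddCommGroup E] [NormedSpace ℝ E]

theorem christoffelFirst_congr {G G' : E → E →L[ℝ] E →L[ℝ] ℝ} {x : E} (h : G =ᶠ[nhds x] G') :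
    christoffelFirst G x = christoffelFirst G' x := by
  simp only [christoffelFirst, h.fderiv_eq]

theorem christoffel_congr {G G' : E → E →L[ℝ] E →L[ℝ] ℝ} {x : E} (h : G =ᶠ[nhds x] G') :
    christoffel G x = christoffel G' x := by
  simp only [christoffel, christoffelFirst_congr h, h.eq_of_nhds]

theorem ricci_congr {G G' : E → E →L[ℝ] E →L[ℝ] ℝ} {x : E} (h : G =ᶠ[nhds x] G') :
    ricci G x = ricci G' x := by
  have h1 : christoffel G =ᶠ[nhds x] christoffel G' :=
    h.eventuallyEq_nhds.mono fun y hy => christoffel_congr hy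
  ext v w
  simp only [ricci, curvature, h1.fderiv_eq, h1.eq_of_nhds]

theorem covDeriv_congr {G G' : E → E →L[ℝ] E →L[ℝ] ℝ} {T T' : E → E → E → ℝ} {x : E}
    (hG : G =ᶠ[nhds x] G') (hT : T =ᶠ[nhds x] T') :
    covDeriv G T x = covDeriv G' T' x := by
  ext w u v
  have h1 : (fun y => T y u v) =ᶠ[nhds x] fun y => T' y u v := hT.mono fun y hy => by simp [hy]
  simp only [covDeriv, h1.fderiv_eq, christoffel_congr hG, hT.eq_of_nhds]

theorem covDeriv_ricci_congr {G G' : E → E →L[ℝ] E →L[ℝ] ℝ} {x : E} (h : G =ᶠ[nhds x] G') :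
    covDeriv G (ricci G) x = covDeriv G' (ricci G') x :=
  covDeriv_congr h (h.eventuallyEq_nhds.mono fun _ hy => ricci_congr hy)

theorem contDiffAt_christoffelFirst {G : E → E →L[ℝ] E →L[ℝ] ℝ} {x : E}
    (hG : ContDiffAt ℝ ∞ G x) :
    ContDiffAt ℝ ∞ (christoffelFirst G) x := by
  have h : ContDiffAt ℝ ∞ (fderiv ℝ G) x := hG.fderiv_right (by simp)
  have h2 : ContDiffAt ℝ ∞ (fun y => (fderiv ℝ G y).flip) x :=
    (ContinuousLinearMap.flipₗᵢ ℝ E E (E →L[ℝ] ℝ)).contDiff.contDiffAt.comp x h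
  exact (h.add h2).sub (contDiffAt_const.clm_comp h2)

section Smooth

variable [FiniteDimensional ℝ E] {G : E → E →L[ℝ] E →L[ℝ] ℝ} {x : E}

theorem contDiffAt_inverse (hG : ContDiffAt ℝ ∞ G x) (hx : (G x).IsInvertible) :
    ContDiffAt ℝ ∞ (fun y => (G y).inverse) x := by
  have : CompleteSpace E := FiniteDimensional.complete ℝ E
  exact (hx.contDiffAt_map_inverse).comp x hG

theorem contDiffAt_christoffel (hG : ContDiffAt ℝ ∞ G x) (hx : (G x).IsInvertible) :
    ContDiffAt ℝ ∞ (christoffel G) x := by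
  have h1 : ContDiffAt ℝ ∞
      (fun y => ContinuousLinearMap.compL ℝ E (E →L[ℝ] ℝ) E (G y).inverse) x :=
    (ContinuousLinearMap.compL ℝ E (E →L[ℝ] ℝ) E).contDiff.contDiffAt.comp x
      (contDiffAt_inverse hG hx)
  exact (h1.clm_comp (contDiffAt_christoffelFirst hG)).const_smul (1 / 2 : ℝ)

theorem contDiffAt_curvature (hG : ContDiffAt ℝ ∞ G x) (hx : (G x).IsInvertible) (v w : E) :
    ContDiffAt ℝ ∞ (fun y => curvature G y v w) x := by
  have hΓ := contDiffAt_christoffel hG hx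
  have hdΓ : ContDiffAt ℝ ∞ (fderiv ℝ (christoffel G)) x := hΓ.fderiv_right (by simp)
  have hflip : ∀ {T : E → E →L[ℝ] E →L[ℝ] E}, ContDiffAt ℝ ∞ T x →
      ContDiffAt ℝ ∞ (fun y => (T y).flip) x := fun h =>
    (ContinuousLinearMap.flipₗᵢ ℝ E E E).contDiff.contDiffAt.comp x h
  have hflip' : ContDiffAt ℝ ∞ (fun y => (fderiv ℝ (christoffel G) y).flip) x :=
    (ContinuousLinearMap.flipₗᵢ ℝ E E (E →L[ℝ] E)).contDiff.contDiffAt.comp x hdΓ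
  have happ : ∀ {T : E → E →L[ℝ] E →L[ℝ] E} (u : E), ContDiffAt ℝ ∞ T x →
      ContDiffAt ℝ ∞ (fun y => T y u) x := fun u h => h.clm_apply contDiffAt_const
  refine ContDiffAt.sub (ContDiffAt.add (ContDiffAt.sub ?_ ?_) ?_) ?_
  · exact (hflip (hflip'.clm_apply contDiffAt_const)).clm_apply contDiffAt_const
  · exact (hflip (hdΓ.clm_apply contDiffAt_const)).clm_apply contDiffAt_const
  · exact (hflip hΓ).clm_apply ((happ v hΓ).clm_apply contDiffAt_const)
  · exact (happ v hΓ).clm_comp ((hflip hΓ).clm_apply contDiffAt_const)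

theorem contDiffAt_ricci (hG : ContDiffAt ℝ ∞ G x) (hx : (G x).IsInvertible) (v w : E) :
    ContDiffAt ℝ ∞ (fun y => ricci G y v w) x := by
  have h : ContDiff ℝ ∞ (fun A : E →L[ℝ] E => LinearMap.trace ℝ E (A : E →ₗ[ℝ] E)) :=
    (LinearMap.toContinuousLinearMap
      (LinearMap.trace ℝ E ∘ₗ ContinuousLinearMap.coeLM ℝ)).contDiff
  exact h.contDiffAt.comp x (contDiffAt_curvature hG hx v w)

theorem contDiffAt_hessian {φ : E → ℝ} (hG : ContDiffAt ℝ ∞ G x) (hx : (G x).IsInvertible)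
    (hφ : ContDiffAt ℝ ∞ φ x) : ContDiffAt ℝ ∞ (hessian G φ) x := by
  have h1 : ContDiffAt ℝ ∞ (fderiv ℝ φ) x := hφ.fderiv_right (by simp)
  have h2 : ContDiffAt ℝ ∞ (fderiv ℝ (fderiv ℝ φ)) x := h1.fderiv_right (by simp)
  have h3 : ContDiffAt ℝ ∞ (fun y => ContinuousLinearMap.compL ℝ E E ℝ (fderiv ℝ φ y)) x :=
    (ContinuousLinearMap.compL ℝ E E ℝ).contDiff.contDiffAt.comp x h1
  exact h2.sub (h3.clm_comp (contDiffAt_christoffel hG hx))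

end Smooth

theorem ricci_add_right (G : E → E →L[ℝ] E →L[ℝ] ℝ) (x v w w' : E) :
    ricci G x v (w + w') = ricci G x v w + ricci G x v w' := by
  simp only [ricci, ← map_add, ← ContinuousLinearMap.toLinearMap_add]
  congr 2
  ext u
  simp only [add_apply, curvature_apply, map_add]
  abel

theorem ricci_smul_right (G : E → E →L[ℝ] E →L[ℝ] ℝ) (x v w : E) (c : ℝ) :
    ricci G x v (c • w) = c * ricci G x v w := by
  rw [← smul_eq_mul, ricci, ricci, ← map_smul, ← ContinuousLinearMap.toLinearMap_smul]
  congr 2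
  ext u
  simp only [smul_apply, curvature_apply, map_smul, smul_sub, smul_add]

theorem apply_christoffel {G : E → E →L[ℝ] E →L[ℝ] ℝ} {x : E} (hx : (G x).IsInvertible)
    (u v z : E) : G x (christoffel G x u v) z = (1 / 2 : ℝ) * christoffelFirst G x u v z := by
  rw [christoffel_apply, map_smul, hx.self_apply_inverse]
  rfl

theorem apply_grad {G : E → E →L[ℝ] E →L[ℝ] ℝ} {x : E} (hx : (G x).IsInvertible)
    (φ : E → ℝ) (z : E) : G x (grad G φ x) z = fderiv ℝ φ x z := by
  rw [grad, hx.self_apply_inverse]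

theorem christoffel_eq_of_apply {G : E → E →L[ℝ] E →L[ℝ] ℝ} {x : E} (hx : (G x).IsInvertible)
    {u v a : E} (h : ∀ z, G x a z = (1 / 2 : ℝ) * christoffelFirst G x u v z) :
    christoffel G x u v = a :=
  hx.injective (ContinuousLinearMap.ext fun z => by rw [apply_christoffel hx, h])

theorem christoffel_symm {G : E → E →L[ℝ] E →L[ℝ] ℝ} {x : E} (hx : (G x).IsInvertible)
    (hd : DifferentiableAt ℝ G x) (hs : ∀ᶠ y in nhds x, ∀ u v, G y u v = G y v u) (u v : E) :
    christoffel G x u v = christoffel G x v u := by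
  refine christoffel_eq_of_apply hx fun z => ?_
  have h : (fun y => G y u v) =ᶠ[nhds x] fun y => G y v u := hs.mono fun y hy => hy u v
  rw [apply_christoffel hx, christoffelFirst_apply, christoffelFirst_apply,
    fderiv_apply_apply hd z u v, fderiv_apply_apply hd z v u, h.fderiv_eq]
  ring

end LocalTensor

theorem contDiff_pullbackForm {V W : Type*} [NormedAddCommGroup V] [NormedSpace ℝ V]
    [NormedAddCommGroup W] [NormedSpace ℝ W] [FiniteDimensional ℝ W] (A : V →L[ℝ] W) :
    ContDiff ℝ ∞ (pullbackForm A) :=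
  (LinearMap.toContinuousLinearMap
    ({ toFun := pullbackForm A
       map_add' := fun _ _ => rfl
       map_smul' := fun _ _ => rfl } :
      (W →L[ℝ] W →L[ℝ] ℝ) →ₗ[ℝ] (V →L[ℝ] V →L[ℝ] ℝ))).contDiff

namespace LocalTensor

variable {E : Type*} [NormedAddCommGroup E] [NormedSpace ℝ E]

theorem fderiv_apply_apply_fst {T : ℝ × E → (ℝ × E) →L[ℝ] (ℝ × E) →L[ℝ] ℝ × E} {p : ℝ × E}
    (hT : DifferentiableAt ℝ T p) (u v w : ℝ × E) {a : ℝ → ℝ} {b : E → ℝ}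
    (ha : DifferentiableAt ℝ a p.1) (hb : DifferentiableAt ℝ b p.2)
    (h : ∀ᶠ q in nhds p, (T q v w).1 = a q.1 • b q.2) :
    (fderiv ℝ T p u v w).1 = (u.1 * deriv a p.1) • b p.2 + a p.1 • fderiv ℝ b p.2 u.2 := by
  rw [fderiv_apply_apply hT, ← fderiv_smul_prod ha hb]
  have h1 : (fun q => (T q v w).1) =ᶠ[nhds p] fun q => a q.1 • b q.2 := h
  rw [← h1.fderiv_eq, (hT.apply_apply v w).hasFDerivAt.fst.fderiv]
  rfl

theorem fderiv_apply_apply_snd {T : ℝ × E → (ℝ × E) →L[ℝ] (ℝ × E) →L[ℝ] ℝ × E} {p : ℝ × E}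
    (hT : DifferentiableAt ℝ T p) (u v w : ℝ × E) {a : ℝ → ℝ} {b : E → E}
    (ha : DifferentiableAt ℝ a p.1) (hb : DifferentiableAt ℝ b p.2)
    (h : ∀ᶠ q in nhds p, (T q v w).2 = a q.1 • b q.2) :
    (fderiv ℝ T p u v w).2 = (u.1 * deriv a p.1) • b p.2 + a p.1 • fderiv ℝ b p.2 u.2 := by
  rw [fderiv_apply_apply hT, ← fderiv_smul_prod ha hb]
  have h1 : (fun q => (T q v w).2) =ᶠ[nhds p] fun q => a q.1 • b q.2 := h
  rw [← h1.fderiv_eq, (hT.apply_apply v w).hasFDerivAt.snd.fderiv]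
  rfl

/-- `G` is a smooth pseudo-Riemannian metric on the open set `U`. -/
structure IsMetricOn (G : E → E →L[ℝ] E →L[ℝ] ℝ) (U : Set E) : Prop where
  isOpen : IsOpen U
  contDiffAt : ∀ x ∈ U, ContDiffAt ℝ ∞ G x
  symm : ∀ x ∈ U, ∀ u v, G x u v = G x v u
  isInvertible : ∀ x ∈ U, (G x).IsInvertible

/-- `φ` is smooth and nowhere zero on the set `U`. -/
structure IsWarpingOn (φ : E → ℝ) (U : Set E) : Prop where
  contDiffAt : ∀ x ∈ U, ContDiffAt ℝ ∞ φ x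
  ne_zero : ∀ x ∈ U, φ x ≠ 0

/-- The doubly warped metric `-φ² dt² + σ² G` on `ℝ × E`. -/
noncomputable def warpedMetric (σ : ℝ → ℝ) (φ : E → ℝ) (G : E → E →L[ℝ] E →L[ℝ] ℝ) (p : ℝ × E) :
    (ℝ × E) →L[ℝ] (ℝ × E) →L[ℝ] ℝ :=
  (φ p.2) ^ 2 • pullbackForm (ContinuousLinearMap.fst ℝ ℝ E) (negDtSq p.1)
    + (σ p.1) ^ 2 • pullbackForm (ContinuousLinearMap.snd ℝ ℝ E) (G p.2)

theorem warpedMetric_apply (σ : ℝ → ℝ) (φ : E → ℝ) (G : E → E →L[ℝ] E →L[ℝ] ℝ)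
    (p v w : ℝ × E) :
    warpedMetric σ φ G p v w
      = (1 : ℝ) • (-(φ p.2 ^ 2 * (v.1 * w.1))) + σ p.1 ^ 2 • G p.2 v.2 w.2 := by
  simp [warpedMetric, pullbackForm, negDtSq]

section

variable [FiniteDimensional ℝ E] {G : E → E →L[ℝ] E →L[ℝ] ℝ} {σ : ℝ → ℝ} {φ : E → ℝ}

theorem contDiffAt_warpedMetric {p : ℝ × E} (hσ : ContDiffAt ℝ ∞ σ p.1)
    (hφ : ContDiffAt ℝ ∞ φ p.2) (hG : ContDiffAt ℝ ∞ G p.2) :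
    ContDiffAt ℝ ∞ (warpedMetric σ φ G) p := by
  have h1 : ContDiffAt ℝ ∞ (fun q : ℝ × E => φ q.2 ^ 2) p := (hφ.comp p contDiffAt_snd).pow 2
  have h2 : ContDiffAt ℝ ∞ (fun q : ℝ × E => σ q.1 ^ 2) p := (hσ.comp p contDiffAt_fst).pow 2
  have h3 : ContDiffAt ℝ ∞ (fun q : ℝ × E =>
      pullbackForm (ContinuousLinearMap.snd ℝ ℝ E) (G q.2)) p :=
    (contDiff_pullbackForm _).contDiffAt.comp p (hG.comp p contDiffAt_snd)
  have h4 : ContDiffAt ℝ ∞ (fun q : ℝ × E =>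
      pullbackForm (ContinuousLinearMap.fst ℝ ℝ E) (negDtSq q.1)) p :=
    contDiffAt_const (c := pullbackForm (ContinuousLinearMap.fst ℝ ℝ E) (negDtSq 0))
  exact (h1.smul h4).add (h2.smul h3)

theorem isInvertible_warpedMetric {p : ℝ × E} (hσ : σ p.1 ≠ 0) (hφ : φ p.2 ≠ 0)
    (hG : (G p.2).IsInvertible) : (warpedMetric σ φ G p).IsInvertible := by
  refine ContinuousLinearMap.isInvertible_of_ker_trivial _ fun v hv => ?_
  have h : ∀ w, warpedMetric σ φ G p v w = 0 := fun w => by rw [hv]; rfl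
  have hv1 : v.1 = 0 := by
    have h1 := h (1, 0)
    simp only [warpedMetric_apply, map_zero] at h1
    simpa [hφ] using h1
  have hv2 : G p.2 v.2 = 0 := by
    ext b
    have h2 := h (0, b)
    rw [warpedMetric_apply] at h2
    simpa [hσ] using h2
  have hv3 : v.2 = 0 := hG.injective (by rw [hv2, map_zero])
  exact Prod.ext hv1 hv3

end

namespace IsMetricOn

variable {G : E → E →L[ℝ] E →L[ℝ] ℝ} {U : Set E} {x : E}

theorem eventually_symm (hG : IsMetricOn G U) (hx : x ∈ U) :
    ∀ᶠ y in nhds x, ∀ u v, G y u v = G y v u :=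
  Filter.eventually_of_mem (hG.isOpen.mem_nhds hx) hG.symm

theorem differentiableAt (hG : IsMetricOn G U) (hx : x ∈ U) : DifferentiableAt ℝ G x :=
  (hG.contDiffAt x hx).differentiableAt (by simp)

theorem christoffel_symm (hG : IsMetricOn G U) (hx : x ∈ U) (u v : E) :
    christoffel G x u v = christoffel G x v u :=
  LocalTensor.christoffel_symm (hG.isInvertible x hx) (hG.differentiableAt hx)
    (hG.eventually_symm hx) u v

theorem fderiv_symm (hG : IsMetricOn G U) (hx : x ∈ U) (w u v : E) :
    fderiv ℝ G x w u v = fderiv ℝ G x w v u := by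
  rw [fderiv_apply_apply (hG.differentiableAt hx), fderiv_apply_apply (hG.differentiableAt hx)]
  have h : (fun y => G y u v) =ᶠ[nhds x] fun y => G y v u :=
    (hG.eventually_symm hx).mono fun y hy => hy u v
  rw [h.fderiv_eq]

/-- The Levi-Civita connection is metric. -/
theorem fderiv_eq (hG : IsMetricOn G U) (hx : x ∈ U) (w u v : E) :
    fderiv ℝ G x w u v = G x (christoffel G x w u) v + G x u (christoffel G x w v) := by
  rw [hG.symm x hx u, apply_christoffel (hG.isInvertible x hx),
    apply_christoffel (hG.isInvertible x hx), christoffelFirst_apply, christoffelFirst_apply,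
    hG.fderiv_symm hx w v u, hG.fderiv_symm hx u w v, hG.fderiv_symm hx v w u]
  ring

theorem differentiableAt_christoffel [FiniteDimensional ℝ E] (hG : IsMetricOn G U) (hx : x ∈ U) :
    DifferentiableAt ℝ (christoffel G) x :=
  (contDiffAt_christoffel (hG.contDiffAt x hx) (hG.isInvertible x hx)).differentiableAt (by simp)

variable [FiniteDimensional ℝ E] {σ : ℝ → ℝ} {φ : E → ℝ} {J : Set ℝ}

theorem warped (hG : IsMetricOn G U) (hφ : IsWarpingOn φ U) (hJ : IsOpen J)
    (hσ : IsWarpingOn σ J) : IsMetricOn (warpedMetric σ φ G) (J ×ˢ U) where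
  isOpen := hJ.prod hG.isOpen
  contDiffAt p hp := contDiffAt_warpedMetric (hσ.contDiffAt p.1 hp.1) (hφ.contDiffAt p.2 hp.2)
    (hG.contDiffAt p.2 hp.2)
  symm p hp v w := by
    rw [warpedMetric_apply, warpedMetric_apply, hG.symm p.2 hp.2 v.2, mul_comm v.1]
  isInvertible p hp := isInvertible_warpedMetric (hσ.ne_zero p.1 hp.1) (hφ.ne_zero p.2 hp.2)
    (hG.isInvertible p.2 hp.2)

end IsMetricOn

theorem IsWarpingOn.differentiableAt {φ : E → ℝ} {U : Set E} (hφ : IsWarpingOn φ U) {x : E}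
    (hx : x ∈ U) : DifferentiableAt ℝ φ x :=
  (hφ.contDiffAt x hx).differentiableAt (by simp)

section Warped

variable [FiniteDimensional ℝ E] {G : E → E →L[ℝ] E →L[ℝ] ℝ} {U : Set E}
  {σ : ℝ → ℝ} {φ : E → ℝ} {J : Set ℝ} {p : ℝ × E}

theorem fderiv_warpedMetric (hG : IsMetricOn G U) (hφ : IsWarpingOn φ U) (hJ : IsOpen J)
    (hσ : IsWarpingOn σ J) (hp : p ∈ J ×ˢ U) (u v w : ℝ × E) :
    fderiv ℝ (warpedMetric σ φ G) p u v w
      = -(2 * φ p.2 * fderiv ℝ φ p.2 u.2 * (v.1 * w.1))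
        + 2 * σ p.1 * deriv σ p.1 * u.1 * G p.2 v.2 w.2
        + σ p.1 ^ 2 * fderiv ℝ G p.2 u.2 v.2 w.2 := by
  have hφ' := hφ.differentiableAt hp.2
  have hσ' := hσ.differentiableAt hp.1
  have hG' := hG.differentiableAt hp.2
  rw [fderiv_apply_apply ((hG.warped hφ hJ hσ).differentiableAt hp),
    fderiv_apply_apply hG', funext fun q => warpedMetric_apply σ φ G q v w]
  have hb : HasFDerivAt (fun y => -(φ y ^ 2 * (v.1 * w.1)))
      (-((v.1 * w.1) • ((2 * φ p.2) • fderiv ℝ φ p.2))) p.2 := by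
    have h := ((hφ'.hasFDerivAt.pow 2).mul_const (v.1 * w.1)).neg
    convert! h using 4
    simp
  have ha : HasDerivAt (fun s => σ s ^ 2) (2 * σ p.1 * deriv σ p.1) p.1 := by
    convert! hσ'.hasDerivAt.pow 2 using 1
    simp
  have h1 := differentiableAt_smul_prod (p := p) (differentiableAt_const (1 : ℝ))
    hb.differentiableAt
  have h2 := differentiableAt_smul_prod (p := p) ha.differentiableAt
    (hG'.apply_apply v.2 w.2)
  rw [fderiv_fun_add h1 h2, add_apply,
    fderiv_smul_prod (differentiableAt_const (1 : ℝ)) hb.differentiableAt,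
    fderiv_smul_prod ha.differentiableAt (hG'.apply_apply v.2 w.2), hb.fderiv, ha.deriv]
  simp
  ring

theorem christoffel_warpedMetric (hG : IsMetricOn G U) (hφ : IsWarpingOn φ U) (hJ : IsOpen J)
    (hσ : IsWarpingOn σ J) (hp : p ∈ J ×ˢ U) (v w : ℝ × E) :
    christoffel (warpedMetric σ φ G) p v w
      = ((v.1 * fderiv ℝ φ p.2 w.2 + w.1 * fderiv ℝ φ p.2 v.2) / φ p.2
          + σ p.1 * deriv σ p.1 * (G p.2 v.2 w.2 / φ p.2 ^ 2),
        christoffel G p.2 v.2 w.2 + (deriv σ p.1 / σ p.1) • (v.1 • w.2 + w.1 • v.2)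
          + (v.1 * w.1) • ((1 / σ p.1 ^ 2) • (φ p.2 • grad G φ p.2))) := by
  refine christoffel_eq_of_apply ((hG.warped hφ hJ hσ).isInvertible p hp) fun z => ?_
  have h1 := hφ.ne_zero p.2 hp.2
  have h2 := hσ.ne_zero p.1 hp.1
  have hi := hG.isInvertible p.2 hp.2
  simp only [christoffelFirst_apply, fderiv_warpedMetric hG hφ hJ hσ hp, warpedMetric_apply,
    map_add, map_smul, add_apply, smul_apply, smul_eq_mul,
    apply_christoffel hi, apply_grad hi]
  field_simp
  ring

theorem christoffel_warpedMetric_space_space (hG : IsMetricOn G U) (hφ : IsWarpingOn φ U)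
    (hJ : IsOpen J) (hσ : IsWarpingOn σ J) (hp : p ∈ J ×ˢ U) (v w : E) :
    christoffel (warpedMetric σ φ G) p (0, v) (0, w)
      = (σ p.1 * deriv σ p.1 * (G p.2 v w / φ p.2 ^ 2), christoffel G p.2 v w) := by
  rw [christoffel_warpedMetric hG hφ hJ hσ hp]
  simp

theorem christoffel_warpedMetric_time_space (hG : IsMetricOn G U) (hφ : IsWarpingOn φ U)
    (hJ : IsOpen J) (hσ : IsWarpingOn σ J) (hp : p ∈ J ×ˢ U) (w : E) :
    christoffel (warpedMetric σ φ G) p (1, 0) (0, w)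
      = (fderiv ℝ φ p.2 w / φ p.2, (deriv σ p.1 / σ p.1) • w) := by
  rw [christoffel_warpedMetric hG hφ hJ hσ hp]
  simp

theorem christoffel_warpedMetric_space_time (hG : IsMetricOn G U) (hφ : IsWarpingOn φ U)
    (hJ : IsOpen J) (hσ : IsWarpingOn σ J) (hp : p ∈ J ×ˢ U) (w : E) :
    christoffel (warpedMetric σ φ G) p (0, w) (1, 0)
      = (fderiv ℝ φ p.2 w / φ p.2, (deriv σ p.1 / σ p.1) • w) := by
  rw [christoffel_warpedMetric hG hφ hJ hσ hp]
  simp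

theorem christoffel_warpedMetric_time_time (hG : IsMetricOn G U) (hφ : IsWarpingOn φ U)
    (hJ : IsOpen J) (hσ : IsWarpingOn σ J) (hp : p ∈ J ×ˢ U) :
    christoffel (warpedMetric σ φ G) p (1, 0) (1, 0)
      = (0, (1 / σ p.1 ^ 2) • (φ p.2 • grad G φ p.2)) := by
  rw [christoffel_warpedMetric hG hφ hJ hσ hp]
  simp

end Warped

end LocalTensor

namespace LocalTensor

variable {E : Type*} [NormedAddCommGroup E] [NormedSpace ℝ E]

theorem deriv_deriv_eq_fderiv_fderiv {σ : ℝ → ℝ} {s : ℝ} (hσ : ContDiffAt ℝ ∞ σ s) :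
    fderiv ℝ (fderiv ℝ σ) s 1 1 = deriv (deriv σ) s := by
  have h : DifferentiableAt ℝ (fderiv ℝ σ) s :=
    (hσ.fderiv_right (m := ∞) (by simp)).differentiableAt (by simp)
  have h1 := (((ContinuousLinearMap.apply ℝ ℝ (1 : ℝ)).hasFDerivAt).comp s h.hasFDerivAt)
  have h2 : deriv σ = (ContinuousLinearMap.apply ℝ ℝ (1 : ℝ)) ∘ fderiv ℝ σ := by
    ext t
    simp
  rw [h2, ← fderiv_apply_one_eq_deriv, h1.fderiv]
  rfl

theorem contDiffAt_deriv {σ : ℝ → ℝ} {s : ℝ} (hσ : ContDiffAt ℝ ∞ σ s) :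
    ContDiffAt ℝ ∞ (deriv σ) s := by
  have h : deriv σ = fun t => fderiv ℝ σ t 1 := by
    ext t
    simp
  rw [h]
  exact (hσ.fderiv_right (m := ∞) (by simp)).clm_apply contDiffAt_const

theorem isMetricOn_negDtSq : IsMetricOn negDtSq Set.univ where
  isOpen := isOpen_univ
  contDiffAt _ _ := contDiffAt_const
  symm _ _ u v := by simp [negDtSq, mul_comm]
  isInvertible _ _ := ContinuousLinearMap.isInvertible_of_ker_trivial _ fun v hv => by
    simpa [negDtSq] using congrArg (fun L => L 1) hv

theorem inverse_negDtSq (s : ℝ) (L : ℝ →L[ℝ] ℝ) : (negDtSq s).inverse L = -L 1 := by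
  rw [(isMetricOn_negDtSq.isInvertible s trivial).inverse_apply_eq]
  ext
  simp [negDtSq]

/-- On `(ℝ, -dt²)`: `σ^◇ = -σ σ'' - (m - 1) σ'²`. -/
theorem diamond_negDtSq {σ : ℝ → ℝ} {s : ℝ} (hσ : ContDiffAt ℝ ∞ σ s) (m : ℕ) :
    diamond negDtSq m σ s
      = -(σ s * deriv (deriv σ) s) - ((m : ℝ) - 1) * deriv σ s ^ 2 := by
  have h1 : christoffelFirst negDtSq s = 0 := by
    ext
    rw [christoffelFirst_apply, show negDtSq = fun _ => negDtSq 0 from rfl]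
    simp
  have h2 : christoffel negDtSq s = 0 := by
    ext
    rw [christoffel_apply, h1]
    simp
  have h3 : hessian negDtSq σ s = fderiv ℝ (fderiv ℝ σ) s := by
    rw [hessian, h2]
    simp
  have h4 : laplacian negDtSq σ s = -deriv (deriv σ) s := by
    rw [laplacian, LinearMap.trace_real, ContinuousLinearMap.coe_coe,
      ContinuousLinearMap.comp_apply, inverse_negDtSq, h3, deriv_deriv_eq_fderiv_fderiv hσ]
  rw [diamond, h4, grad, inverse_negDtSq]
  simp [negDtSq]
  ring

section Warped

variable {G : E → E →L[ℝ] E →L[ℝ] ℝ} {U : Set E}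
  {σ : ℝ → ℝ} {φ : E → ℝ} {J : Set ℝ} {p : ℝ × E}

theorem fderiv_fderiv_div (hφ : IsWarpingOn φ U) {x : E} (hx : x ∈ U) (v w : E) :
    fderiv ℝ (fun y => fderiv ℝ φ y w / φ y) x v
      = fderiv ℝ (fderiv ℝ φ) x v w / φ x
        - fderiv ℝ φ x v * fderiv ℝ φ x w / φ x ^ 2 := by
  have h1 : HasFDerivAt (fderiv ℝ φ) (fderiv ℝ (fderiv ℝ φ) x) x :=
    (((hφ.contDiffAt x hx).fderiv_right (m := ∞) (by simp)).differentiableAt (by simp)).hasFDerivAt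
  have h2 : HasFDerivAt (fun y => fderiv ℝ φ y w)
      ((ContinuousLinearMap.apply ℝ ℝ w) ∘L fderiv ℝ (fderiv ℝ φ) x) x :=
    ((ContinuousLinearMap.apply ℝ ℝ w).hasFDerivAt).comp x h1
  rw [fderiv_div_apply h2.differentiableAt (hφ.differentiableAt hx) (hφ.ne_zero x hx), h2.fderiv]
  simp [mul_comm]

theorem differentiableAt_fderiv_div (hφ : IsWarpingOn φ U) {x : E} (hx : x ∈ U) (w : E) :
    DifferentiableAt ℝ (fun y => fderiv ℝ φ y w / φ y) x := by
  have h1 : ContDiffAt ℝ ∞ (fderiv ℝ φ) x := (hφ.contDiffAt x hx).fderiv_right (by simp)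
  exact ((h1.clm_apply contDiffAt_const).div (hφ.contDiffAt x hx)
    (hφ.ne_zero x hx)).differentiableAt (by simp)

theorem differentiableAt_metric_div (hG : IsMetricOn G U) (hφ : IsWarpingOn φ U) {x : E}
    (hx : x ∈ U) (v w : E) :
    DifferentiableAt ℝ (fun y => G y v w / φ y ^ 2) x :=
  ((((hG.contDiffAt x hx).clm_apply contDiffAt_const).clm_apply contDiffAt_const).div
    ((hφ.contDiffAt x hx).pow 2) (pow_ne_zero 2 (hφ.ne_zero x hx))).differentiableAt (by simp)

theorem hasDerivAt_mul_deriv (hσ : IsWarpingOn σ J) {s : ℝ} (hs : s ∈ J) :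
    HasDerivAt (fun t => σ t * deriv σ t)
      (deriv σ s * deriv σ s + σ s * deriv (deriv σ) s) s :=
  (hσ.differentiableAt hs).hasDerivAt.mul
    ((contDiffAt_deriv (hσ.contDiffAt s hs)).differentiableAt (by simp)).hasDerivAt

theorem differentiableAt_deriv_div (hσ : IsWarpingOn σ J) {s : ℝ} (hs : s ∈ J) :
    DifferentiableAt ℝ (fun t => deriv σ t / σ t) s :=
  ((contDiffAt_deriv (hσ.contDiffAt s hs)).div (hσ.contDiffAt s hs)
    (hσ.ne_zero s hs)).differentiableAt (by simp)

theorem fderiv_metric_div (hG : IsMetricOn G U) (hφ : IsWarpingOn φ U) {x : E}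
    (hx : x ∈ U) (w u v : E) :
    fderiv ℝ (fun y => G y u v / φ y ^ 2) x w
      = (G x (christoffel G x w u) v + G x u (christoffel G x w v)) / φ x ^ 2
        - 2 * fderiv ℝ φ x w * G x u v / φ x ^ 3 := by
  have h0 := hφ.ne_zero x hx
  have h2 := (hφ.differentiableAt hx).hasFDerivAt.pow 2
  have h3 : fderiv ℝ (fun y => φ y ^ 2) x w = 2 * φ x * fderiv ℝ φ x w := by
    rw [h2.fderiv]
    simp
  rw [← hG.fderiv_eq hx, fderiv_apply_apply (hG.differentiableAt hx),
    fderiv_div_apply ((hG.differentiableAt hx).apply_apply u v) h2.differentiableAt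
      (pow_ne_zero 2 h0)]
  rw [h3]
  field_simp

theorem differentiableAt_diamond_negDtSq (hJ : IsOpen J) (hσ : IsWarpingOn σ J) {s : ℝ}
    (hs : s ∈ J) (m : ℕ) : DifferentiableAt ℝ (diamond negDtSq m σ) s := by
  have h : diamond negDtSq m σ =ᶠ[nhds s]
      fun t => -(σ t * deriv (deriv σ) t) - ((m : ℝ) - 1) * deriv σ t ^ 2 :=
    Filter.eventually_of_mem (hJ.mem_nhds hs) fun t ht => diamond_negDtSq (hσ.contDiffAt t ht) m
  have h1 := hσ.contDiffAt s hs
  have h2 := contDiffAt_deriv h1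
  have h3 := contDiffAt_deriv h2
  refine DifferentiableAt.congr_of_eventuallyEq ?_ h
  exact ((h1.mul h3).neg.sub (contDiffAt_const.mul (h2.pow 2))).differentiableAt (by simp)

variable [FiniteDimensional ℝ E]

/-- The Ricci tensor of the doubly warped metric in space directions. -/
theorem ricci_warpedMetric_space_space (hG : IsMetricOn G U) (hφ : IsWarpingOn φ U)
    (hJ : IsOpen J) (hσ : IsWarpingOn σ J) (hp : p ∈ J ×ˢ U) (v w : E) :
    ricci (warpedMetric σ φ G) p (0, v) (0, w)
      = ricci G p.2 v w - warpingTensor G 1 φ p.2 v w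
        - diamond negDtSq (Module.finrank ℝ E) σ p.1 * (G p.2 v w / φ p.2 ^ 2) := by
  have hW := hG.warped hφ hJ hσ
  have hd := hW.differentiableAt_christoffel hp
  have hev : ∀ᶠ q in nhds p, q ∈ J ×ˢ U := hW.isOpen.mem_nhds hp
  have hss := hasDerivAt_mul_deriv hσ hp.1
  have hφ0 := hφ.ne_zero p.2 hp.2
  have hσ0 := hσ.ne_zero p.1 hp.1
  rw [ricci, LinearMap.trace_real_prod]
  have h1 : (curvature (warpedMetric σ φ G) p (0, v) (0, w) (1, 0)).1
      = σ p.1 * deriv (deriv σ) p.1 * (G p.2 v w / φ p.2 ^ 2) - warpingTensor G 1 φ p.2 v w := by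
    rw [curvature_apply]
    simp only [Prod.fst_add, Prod.fst_sub]
    rw [fderiv_apply_apply_fst hd (1, 0) (0, v) (0, w) (a := fun t => σ t * deriv σ t)
        (b := fun y => G y v w / φ y ^ 2) hss.differentiableAt
        (differentiableAt_metric_div hG hφ hp.2 v w)
        (hev.mono fun q hq => by
          rw [christoffel_warpedMetric_space_space hG hφ hJ hσ hq]; rfl),
      fderiv_apply_apply_fst hd (0, v) (1, 0) (0, w) (a := fun _ => 1)
        (b := fun y => fderiv ℝ φ y w / φ y) (differentiableAt_const _)
        (differentiableAt_fderiv_div hφ hp.2 w)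
        (hev.mono fun q hq => by
          rw [christoffel_warpedMetric_time_space hG hφ hJ hσ hq, one_smul]),
      christoffel_warpedMetric_space_space hG hφ hJ hσ hp v w,
      christoffel_warpedMetric_time_space hG hφ hJ hσ hp w,
      christoffel_warpedMetric hG hφ hJ hσ hp, christoffel_warpedMetric hG hφ hJ hσ hp,
      hss.deriv, fderiv_fderiv_div hφ hp.2, warpingTensor, hessian]
    simp
    field_simp
    ring
  have h2 : LinearMap.snd ℝ ℝ E ∘ₗ
        (curvature (warpedMetric σ φ G) p (0, v) (0, w) : ℝ × E →ₗ[ℝ] ℝ × E) ∘ₗ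
        LinearMap.inr ℝ ℝ E
      = (curvature G p.2 v w : E →ₗ[ℝ] E)
        + (deriv σ p.1 ^ 2 / φ p.2 ^ 2) • (G p.2 v w • LinearMap.id
          - (G p.2 w : E →ₗ[ℝ] ℝ).smulRight v) := by
    refine LinearMap.ext fun u => ?_
    change (curvature (warpedMetric σ φ G) p (0, v) (0, w) (0, u)).2 = _
    rw [curvature_apply]
    simp only [Prod.snd_add, Prod.snd_sub]
    rw [fderiv_apply_apply_snd hd (0, u) (0, v) (0, w) (a := fun _ => 1)
        (b := fun y => christoffel G y v w) (differentiableAt_const _)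
        ((hG.differentiableAt_christoffel hp.2).apply_apply v w)
        (hev.mono fun q hq => by
          rw [christoffel_warpedMetric_space_space hG hφ hJ hσ hq, one_smul]),
      fderiv_apply_apply_snd hd (0, v) (0, u) (0, w) (a := fun _ => 1)
        (b := fun y => christoffel G y u w) (differentiableAt_const _)
        ((hG.differentiableAt_christoffel hp.2).apply_apply u w)
        (hev.mono fun q hq => by
          rw [christoffel_warpedMetric_space_space hG hφ hJ hσ hq, one_smul]),
      christoffel_warpedMetric_space_space hG hφ hJ hσ hp v w,
      christoffel_warpedMetric_space_space hG hφ hJ hσ hp u w,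
      christoffel_warpedMetric hG hφ hJ hσ hp, christoffel_warpedMetric hG hφ hJ hσ hp,
      ← fderiv_apply_apply (hG.differentiableAt_christoffel hp.2),
      ← fderiv_apply_apply (hG.differentiableAt_christoffel hp.2)]
    simp only [LinearMap.add_apply, LinearMap.smul_apply, LinearMap.sub_apply, LinearMap.id_apply,
      LinearMap.smulRight_apply, ContinuousLinearMap.coe_coe, curvature_apply,
      hG.symm p.2 hp.2 w u]
    simp only [zero_mul, zero_smul, zero_add, one_smul, add_zero, smul_sub, smul_smul]
    have e : ∀ c : ℝ, deriv σ p.1 / σ p.1 * (σ p.1 * deriv σ p.1 * (c / φ p.2 ^ 2))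
        = deriv σ p.1 ^ 2 / φ p.2 ^ 2 * c := fun c => by
      field_simp
    rw [e, e]
    abel
  rw [ContinuousLinearMap.coe_coe, h1, h2, map_add, map_smul, map_sub, map_smul,
    LinearMap.trace_id, LinearMap.trace_smulRight, ← ricci,
    diamond_negDtSq (hσ.contDiffAt p.1 hp.1), ContinuousLinearMap.coe_coe,
    hG.symm p.2 hp.2 w v]
  simp only [smul_eq_mul]
  ring

/-- The mixed components of the Ricci tensor of the doubly warped metric. -/
theorem ricci_warpedMetric_space_time (hG : IsMetricOn G U) (hφ : IsWarpingOn φ U)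
    (hJ : IsOpen J) (hσ : IsWarpingOn σ J) (hp : p ∈ J ×ˢ U) (v : E) :
    ricci (warpedMetric σ φ G) p (0, v) (1, 0)
      = ((Module.finrank ℝ E : ℝ) - 1) * (deriv σ p.1 / σ p.1) * (fderiv ℝ φ p.2 v / φ p.2) := by
  have hW := hG.warped hφ hJ hσ
  have hd := hW.differentiableAt_christoffel hp
  have hev : ∀ᶠ q in nhds p, q ∈ J ×ˢ U := hW.isOpen.mem_nhds hp
  have hφ0 := hφ.ne_zero p.2 hp.2
  have hσ0 := hσ.ne_zero p.1 hp.1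
  have hi := hG.isInvertible p.2 hp.2
  rw [ricci, LinearMap.trace_real_prod]
  have h1 : (curvature (warpedMetric σ φ G) p (0, v) (1, 0) (1, 0)).1 = 0 := by
    rw [curvature_apply]
    simp only [Prod.fst_add, Prod.fst_sub]
    rw [fderiv_apply_apply_fst hd (1, 0) (0, v) (1, 0) (a := fun _ => 1)
        (b := fun y => fderiv ℝ φ y v / φ y) (differentiableAt_const _)
        (differentiableAt_fderiv_div hφ hp.2 v)
        (hev.mono fun q hq => by
          rw [christoffel_warpedMetric_space_time hG hφ hJ hσ hq, one_smul]),
      fderiv_apply_apply_fst hd (0, v) (1, 0) (1, 0) (a := fun _ => 1)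
        (b := fun _ => 0) (differentiableAt_const _) (differentiableAt_const _)
        (hev.mono fun q hq => by
          rw [christoffel_warpedMetric_time_time hG hφ hJ hσ hq, one_smul]),
      christoffel_warpedMetric_space_time hG hφ hJ hσ hp v,
      christoffel_warpedMetric_time_time hG hφ hJ hσ hp,
      christoffel_warpedMetric hG hφ hJ hσ hp, christoffel_warpedMetric hG hφ hJ hσ hp]
    simp [hG.symm p.2 hp.2 v, apply_grad hi]
    field_simp
    ring
  have h2 : LinearMap.snd ℝ ℝ E ∘ₗ
        (curvature (warpedMetric σ φ G) p (0, v) (1, 0) : ℝ × E →ₗ[ℝ] ℝ × E) ∘ₗ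
        LinearMap.inr ℝ ℝ E
      = (deriv σ p.1 / σ p.1) • ((fderiv ℝ φ p.2 v / φ p.2) • LinearMap.id
          - (1 / φ p.2) • (fderiv ℝ φ p.2 : E →ₗ[ℝ] ℝ).smulRight v) := by
    refine LinearMap.ext fun u => ?_
    change (curvature (warpedMetric σ φ G) p (0, v) (1, 0) (0, u)).2 = _
    rw [curvature_apply]
    simp only [Prod.snd_add, Prod.snd_sub]
    rw [fderiv_apply_apply_snd hd (0, u) (0, v) (1, 0) (a := fun t => deriv σ t / σ t)
        (b := fun _ => v) (differentiableAt_deriv_div hσ hp.1) (differentiableAt_const _)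
        (hev.mono fun q hq => by
          rw [christoffel_warpedMetric_space_time hG hφ hJ hσ hq]),
      fderiv_apply_apply_snd hd (0, v) (0, u) (1, 0) (a := fun t => deriv σ t / σ t)
        (b := fun _ => u) (differentiableAt_deriv_div hσ hp.1) (differentiableAt_const _)
        (hev.mono fun q hq => by
          rw [christoffel_warpedMetric_space_time hG hφ hJ hσ hq]),
      christoffel_warpedMetric_space_time hG hφ hJ hσ hp v,
      christoffel_warpedMetric_space_time hG hφ hJ hσ hp u,
      christoffel_warpedMetric hG hφ hJ hσ hp, christoffel_warpedMetric hG hφ hJ hσ hp]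
    simp only [LinearMap.smul_apply, LinearMap.sub_apply, LinearMap.id_apply,
      LinearMap.smulRight_apply, ContinuousLinearMap.coe_coe, map_smul,
      hG.christoffel_symm hp.2 u v]
    simp [smul_sub, smul_smul]
    rw [div_eq_inv_mul (fderiv ℝ φ p.2 u)]
  rw [ContinuousLinearMap.coe_coe, h1, h2, map_smul, map_sub, map_smul, map_smul,
    LinearMap.trace_id, LinearMap.trace_smulRight, ContinuousLinearMap.coe_coe]
  simp only [smul_eq_mul]
  ring

theorem differentiableAt_ricci (hG : IsMetricOn G U) {x : E} (hx : x ∈ U) (u v : E) :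
    DifferentiableAt ℝ (fun y => ricci G y u v) x :=
  (contDiffAt_ricci (hG.contDiffAt x hx) (hG.isInvertible x hx) u v).differentiableAt (by simp)

theorem differentiableAt_warpingTensor (hG : IsMetricOn G U) (hφ : IsWarpingOn φ U) {x : E}
    (hx : x ∈ U) (m : ℕ) (u v : E) :
    DifferentiableAt ℝ (fun y => warpingTensor G m φ y u v) x := by
  have h := contDiffAt_hessian (hG.contDiffAt x hx) (hG.isInvertible x hx) (hφ.contDiffAt x hx)
  have h1 : ContDiffAt ℝ ∞ (fun y => (m : ℝ) / φ y * hessian G φ y u v) x :=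
    (contDiffAt_const.div (hφ.contDiffAt x hx) (hφ.ne_zero x hx)).mul
      ((h.clm_apply contDiffAt_const).clm_apply contDiffAt_const)
  exact h1.differentiableAt (by simp)

/-- The covariant derivative of the Ricci tensor of the doubly warped metric in space directions,
up to a term that is symmetric in the first two arguments. -/
theorem covDeriv_ricci_warpedMetric (hG : IsMetricOn G U) (hφ : IsWarpingOn φ U)
    (hJ : IsOpen J) (hσ : IsWarpingOn σ J) (hp : p ∈ J ×ˢ U) (w u v : E) :
    covDeriv (warpedMetric σ φ G) (ricci (warpedMetric σ φ G)) p (0, w) (0, u) (0, v)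
      = covDeriv G (ricci G) p.2 w u v - covDeriv G (warpingTensor G 1 φ) p.2 w u v
        + 2 * diamond negDtSq (Module.finrank ℝ E) σ p.1
            * (1 / φ p.2 ^ 3) * fderiv ℝ φ p.2 w * G p.2 u v
        - ((Module.finrank ℝ E : ℝ) - 1) * deriv σ p.1 ^ 2
            * (1 / φ p.2 ^ 3) * fderiv ℝ φ p.2 u * G p.2 w v
        + (ricci G p.2 (christoffel G p.2 w u) v
            - warpingTensor G 1 φ p.2 (christoffel G p.2 w u) v
            - diamond negDtSq (Module.finrank ℝ E) σ p.1
              * (G p.2 (christoffel G p.2 w u) v / φ p.2 ^ 2)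
            - ricci (warpedMetric σ φ G) p
                (christoffel (warpedMetric σ φ G) p (0, w) (0, u)) (0, v)) := by
  have hφ0 := hφ.ne_zero p.2 hp.2
  have hσ0 := hσ.ne_zero p.1 hp.1
  have hW := hG.warped hφ hJ hσ
  have hev : (fun q => ricci (warpedMetric σ φ G) q (0, u) (0, v)) =ᶠ[nhds p] fun q =>
      (1 : ℝ) • (ricci G q.2 u v - warpingTensor G 1 φ q.2 u v)
        - diamond negDtSq (Module.finrank ℝ E) σ q.1 • (G q.2 u v / φ q.2 ^ 2) :=
    Filter.eventually_of_mem (hW.isOpen.mem_nhds hp) fun q hq => by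
      simp only [ricci_warpedMetric_space_space hG hφ hJ hσ hq, smul_eq_mul, one_mul]
  have d1 := differentiableAt_ricci hG hp.2 u v
  have d2 := differentiableAt_warpingTensor hG hφ hp.2 1 u v
  have d3 := differentiableAt_metric_div hG hφ hp.2 u v
  have d4 := differentiableAt_diamond_negDtSq hJ hσ hp.1 (Module.finrank ℝ E)
  have hsplit : ((σ p.1 * deriv σ p.1 * (G p.2 w v / φ p.2 ^ 2), christoffel G p.2 w v) : ℝ × E)
      = (σ p.1 * deriv σ p.1 * (G p.2 w v / φ p.2 ^ 2)) • ((1, 0) : ℝ × E)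
        + (0, christoffel G p.2 w v) := by
    simp
  simp only [covDeriv]
  rw [hev.fderiv_eq, fderiv_fun_sub
      (differentiableAt_smul_prod (differentiableAt_const (1 : ℝ)) (d1.fun_sub d2))
      (differentiableAt_smul_prod d4 d3), sub_apply,
    fderiv_smul_prod (differentiableAt_const (1 : ℝ)) (d1.fun_sub d2), fderiv_smul_prod d4 d3,
    fderiv_fun_sub d1 d2, sub_apply, fderiv_metric_div hG hφ hp.2,
    christoffel_warpedMetric_space_space hG hφ hJ hσ hp w v, hsplit, ricci_add_right,
    ricci_smul_right, ricci_warpedMetric_space_time hG hφ hJ hσ hp,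
    ricci_warpedMetric_space_space hG hφ hJ hσ hp]
  simp only [zero_mul, zero_add, smul_eq_mul]
  field_simp
  ring

/-- The skew part of `D Ric` for the doubly warped metric in space directions. -/
theorem covDeriv_ricci_warpedMetric_sub (hG : IsMetricOn G U) (hφ : IsWarpingOn φ U)
    (hJ : IsOpen J) (hσ : IsWarpingOn σ J) (hp : p ∈ J ×ˢ U) (w u v : E) :
    covDeriv (warpedMetric σ φ G) (ricci (warpedMetric σ φ G)) p (0, w) (0, u) (0, v)
        - covDeriv (warpedMetric σ φ G) (ricci (warpedMetric σ φ G)) p (0, u) (0, w) (0, v)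
      = (covDeriv G (ricci G) p.2 w u v - covDeriv G (ricci G) p.2 u w v)
        - (covDeriv G (warpingTensor G 1 φ) p.2 w u v
            - covDeriv G (warpingTensor G 1 φ) p.2 u w v)
        + (2 * diamond negDtSq (Module.finrank ℝ E) σ p.1
              + ((Module.finrank ℝ E : ℝ) - 1) * deriv σ p.1 ^ 2)
            * (1 / φ p.2 ^ 3) * fderiv ℝ φ p.2 w * G p.2 u v
        - (2 * diamond negDtSq (Module.finrank ℝ E) σ p.1
              + ((Module.finrank ℝ E : ℝ) - 1) * deriv σ p.1 ^ 2)
            * (1 / φ p.2 ^ 3) * fderiv ℝ φ p.2 u * G p.2 w v := by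
  rw [covDeriv_ricci_warpedMetric hG hφ hJ hσ hp, covDeriv_ricci_warpedMetric hG hφ hJ hσ hp,
    hG.christoffel_symm hp.2 u w, (hG.warped hφ hJ hσ).christoffel_symm hp (0, u) (0, w)]
  ring

end Warped

end LocalTensor

theorem isOpen_extend_target_self {E M : Type*} [NormedAddCommGroup E] [NormedSpace ℝ E]
    [TopologicalSpace M] {e : OpenPartialHomeomorph M E} : IsOpen (e.extend 𝓘(ℝ, E)).target := by
  rw [OpenPartialHomeomorph.extend_target']
  simpa using e.open_target

section Chart

variable {E : Type*} [NormedAddCommGroup E] [NormedSpace ℝ E]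
  {M : Type*} [TopologicalSpace M] [ChartedSpace E M]
  {e : OpenPartialHomeomorph M E}

theorem contMDiffAt_extend_symm_self (he : e ∈ IsManifold.maximalAtlas 𝓘(ℝ, E) ∞ M) {y : E}
    (hy : y ∈ (e.extend 𝓘(ℝ, E)).target) :
    ContMDiffAt 𝓘(ℝ, E) 𝓘(ℝ, E) ∞ (e.extend 𝓘(ℝ, E)).symm y := by
  have h := contMDiffOn_extend_symm he
  rw [← OpenPartialHomeomorph.extend_target'] at h
  exact h.contMDiffAt (isOpen_extend_target_self.mem_nhds hy)

theorem mdifferentiableAt_extend_symm_self (he : e ∈ IsManifold.maximalAtlas 𝓘(ℝ, E) ∞ M) {y : E}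
    (hy : y ∈ (e.extend 𝓘(ℝ, E)).target) :
    MDifferentiableAt 𝓘(ℝ, E) 𝓘(ℝ, E) (e.extend 𝓘(ℝ, E)).symm y :=
  (contMDiffAt_extend_symm_self he hy).mdifferentiableAt (by simp)

theorem mfderiv_extend_symm_self_injective (he : e ∈ IsManifold.maximalAtlas 𝓘(ℝ, E) ∞ M) {y : E}
    (hy : y ∈ (e.extend 𝓘(ℝ, E)).target) :
    Function.Injective (mfderiv 𝓘(ℝ, E) 𝓘(ℝ, E) (e.extend 𝓘(ℝ, E)).symm y) := by
  have hs : (e.extend 𝓘(ℝ, E)).symm y ∈ e.source := by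
    rw [← e.extend_source (I := 𝓘(ℝ, E))]
    exact (e.extend 𝓘(ℝ, E)).map_target hy
  have h1 : MDifferentiableAt 𝓘(ℝ, E) 𝓘(ℝ, E) (e.extend 𝓘(ℝ, E))
      ((e.extend 𝓘(ℝ, E)).symm y) :=
    (e.contMDiffAt_extend he hs).mdifferentiableAt (by simp)
  have h2 : e.extend 𝓘(ℝ, E) ∘ (e.extend 𝓘(ℝ, E)).symm =ᶠ[nhds y] id :=
    Filter.eventually_of_mem (isOpen_extend_target_self.mem_nhds hy)
      fun z hz => (e.extend 𝓘(ℝ, E)).right_inv hz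
  have h3 := mfderiv_comp y h1 (mdifferentiableAt_extend_symm_self he hy)
  rw [h2.mfderiv_eq, mfderiv_id] at h3
  refine Function.LeftInverse.injective
    (g := mfderiv 𝓘(ℝ, E) 𝓘(ℝ, E) (e.extend 𝓘(ℝ, E)) ((e.extend 𝓘(ℝ, E)).symm y)) fun v => ?_
  exact (DFunLike.congr_fun h3 v).symm

theorem isWarpingOn_comp_extend_symm (he : e ∈ IsManifold.maximalAtlas 𝓘(ℝ, E) ∞ M) {f : M → ℝ}
    (hf : ContMDiff 𝓘(ℝ, E) 𝓘(ℝ, ℝ) ∞ f) (hfpos : ∀ p, 0 < f p) :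
    LocalTensor.IsWarpingOn (f ∘ (e.extend 𝓘(ℝ, E)).symm) (e.extend 𝓘(ℝ, E)).target where
  contDiffAt _ hy := (hf.contMDiffAt.comp _ (contMDiffAt_extend_symm_self he hy)).contDiffAt
  ne_zero _ _ := (hfpos _).ne'

variable [IsManifold 𝓘(ℝ, E) ∞ M]

theorem contMDiffAt_mfderiv_extend_symm_self (he : e ∈ IsManifold.maximalAtlas 𝓘(ℝ, E) ∞ M)
    {y : E} (hy : y ∈ (e.extend 𝓘(ℝ, E)).target) (v : E) :
    ContMDiffAt 𝓘(ℝ, E) (𝓘(ℝ, E).prod 𝓘(ℝ, E)) ∞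
      (fun z : E => Bundle.TotalSpace.mk' E (E := fun p : M => TangentSpace 𝓘(ℝ, E) p)
        ((e.extend 𝓘(ℝ, E)).symm z)
        (mfderiv 𝓘(ℝ, E) 𝓘(ℝ, E) (e.extend 𝓘(ℝ, E)).symm z v)) y := by
  have hU : IsOpen (e.extend 𝓘(ℝ, E)).target := isOpen_extend_target_self
  have h : ContMDiffOn 𝓘(ℝ, E) 𝓘(ℝ, E) ∞ (e.extend 𝓘(ℝ, E)).symm (e.extend 𝓘(ℝ, E)).target :=
    fun z hz => (contMDiffAt_extend_symm_self he hz).contMDiffWithinAt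
  have : IsManifold 𝓘(ℝ, E) 1 M := IsManifold.of_le (n := ∞) (by simp)
  have ht := h.contMDiffOn_tangentMapWithin (m := ∞) (by simp) hU.uniqueMDiffOn
  have hv : ContMDiffAt 𝓘(ℝ, E) (𝓘(ℝ, E).prod 𝓘(ℝ, E)) ∞
      (fun z : E => Bundle.TotalSpace.mk' E (E := fun p : E => TangentSpace 𝓘(ℝ, E) p) z v) y :=
    contMDiffAt_vectorSpace_iff_contDiffAt.2 contDiffAt_const
  have hc := (ht.comp (s := (e.extend 𝓘(ℝ, E)).target)
    (fun z _ => (contMDiffAt_vectorSpace_iff_contDiffAt (V := fun _ => v)).2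
      contDiffAt_const |>.contMDiffWithinAt) fun z hz => hz).contMDiffAt (hU.mem_nhds hy)
  refine hc.congr_of_eventuallyEq (Filter.eventually_of_mem (hU.mem_nhds hy) fun z hz => ?_)
  simp only [Function.comp_apply, tangentMapWithin]
  rw [mfderivWithin_of_isOpen hU hz]

theorem inChart_self_pos
    (g : Bundle.ContMDiffRiemannianMetric 𝓘(ℝ, E) ∞ E (fun p : M => TangentSpace 𝓘(ℝ, E) p))
    (he : e ∈ IsManifold.maximalAtlas 𝓘(ℝ, E) ∞ M) {y : E}
    (hy : y ∈ (e.extend 𝓘(ℝ, E)).target) {v : E} (hv : v ≠ 0) :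
    0 < inChart (I := 𝓘(ℝ, E)) g.inner e y v v :=
  g.pos ((e.extend 𝓘(ℝ, E)).symm y) (mfderiv 𝓘(ℝ, E) 𝓘(ℝ, E) (e.extend 𝓘(ℝ, E)).symm y v)
    fun h0 => hv (mfderiv_extend_symm_self_injective he hy (h0.trans (map_zero _).symm))

theorem inChart_symm
    (g : Bundle.ContMDiffRiemannianMetric 𝓘(ℝ, E) ∞ E (fun p : M => TangentSpace 𝓘(ℝ, E) p))
    (y u v : E) :
    inChart (I := 𝓘(ℝ, E)) g.inner e y u v = inChart (I := 𝓘(ℝ, E)) g.inner e y v u :=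
  g.symm ((e.extend 𝓘(ℝ, E)).symm y) (mfderiv 𝓘(ℝ, E) 𝓘(ℝ, E) (e.extend 𝓘(ℝ, E)).symm y u)
    (mfderiv 𝓘(ℝ, E) 𝓘(ℝ, E) (e.extend 𝓘(ℝ, E)).symm y v)

variable [FiniteDimensional ℝ E]

theorem contDiffAt_inChart
    (g : Bundle.ContMDiffRiemannianMetric 𝓘(ℝ, E) ∞ E (fun p : M => TangentSpace 𝓘(ℝ, E) p))
    (he : e ∈ IsManifold.maximalAtlas 𝓘(ℝ, E) ∞ M) {y : E}
    (hy : y ∈ (e.extend 𝓘(ℝ, E)).target) :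
    ContDiffAt ℝ ∞ (inChart (I := 𝓘(ℝ, E)) g.inner e) y := by
  have hU : IsOpen (e.extend 𝓘(ℝ, E)).target := isOpen_extend_target_self
  have key : ∀ u v : E, ContDiffOn ℝ ∞ (fun z => inChart (I := 𝓘(ℝ, E)) g.inner e z u v)
      (e.extend 𝓘(ℝ, E)).target := by
    intro u v z hz
    have h1 : ContMDiffAt 𝓘(ℝ, E) (𝓘(ℝ, E).prod 𝓘(ℝ, ℝ)) ∞
        (fun m => Bundle.TotalSpace.mk' ℝ (E := Bundle.Trivial M ℝ)
          ((e.extend 𝓘(ℝ, E)).symm m) (g.inner ((e.extend 𝓘(ℝ, E)).symm m)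
            (mfderiv 𝓘(ℝ, E) 𝓘(ℝ, E) (e.extend 𝓘(ℝ, E)).symm m u)
            (mfderiv 𝓘(ℝ, E) 𝓘(ℝ, E) (e.extend 𝓘(ℝ, E)).symm m v))) z := by
      apply ContMDiffAt.clm_bundle_apply₂ (F₁ := E) (F₂ := E)
      · exact g.contMDiff.contMDiffAt.comp z (contMDiffAt_extend_symm_self he hz)
      · exact contMDiffAt_mfderiv_extend_symm_self he hz u
      · exact contMDiffAt_mfderiv_extend_symm_self he hz v
    rw [Bundle.contMDiffAt_totalSpace] at h1
    exact h1.2.contDiffAt.contDiffWithinAt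
  exact (contDiffOn_clm_apply.2 fun u => contDiffOn_clm_apply.2 fun v => key u v).contDiffAt
    (hU.mem_nhds hy)

theorem isMetricOn_inChart
    (g : Bundle.ContMDiffRiemannianMetric 𝓘(ℝ, E) ∞ E (fun p : M => TangentSpace 𝓘(ℝ, E) p))
    (he : e ∈ IsManifold.maximalAtlas 𝓘(ℝ, E) ∞ M) :
    LocalTensor.IsMetricOn (inChart (I := 𝓘(ℝ, E)) g.inner e) (e.extend 𝓘(ℝ, E)).target where
  isOpen := isOpen_extend_target_self
  contDiffAt y hy := contDiffAt_inChart g he hy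
  symm y _ u v := inChart_symm g y u v
  isInvertible y hy := by
    refine ContinuousLinearMap.isInvertible_of_ker_trivial _ fun v hv => ?_
    by_contra hne
    have h := inChart_self_pos g he hy hne
    rw [hv] at h
    exact lt_irrefl _ h

end Chart

section Interval

variable {J : TopologicalSpace.Opens ℝ} (t : J)

theorem coe_chartAt_symm {s : ℝ} (hs : s ∈ ((chartAt ℝ t).extend 𝓘(ℝ, ℝ)).target) :
    ((((chartAt ℝ t).extend 𝓘(ℝ, ℝ)).symm s : J) : ℝ) = s :=
  ((chartAt ℝ t).extend 𝓘(ℝ, ℝ)).right_inv hs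

theorem coe_mem_chartAt_target : (t : ℝ) ∈ ((chartAt ℝ t).extend 𝓘(ℝ, ℝ)).target :=
  mem_extChartAt_target (I := 𝓘(ℝ, ℝ)) t

theorem inChart_negDtSqOn {s : ℝ} (hs : s ∈ ((chartAt ℝ t).extend 𝓘(ℝ, ℝ)).target) :
    inChart (I := 𝓘(ℝ, ℝ)) (negDtSqOn J) (chartAt ℝ t) s = negDtSq s := by
  have he : chartAt ℝ t ∈ IsManifold.maximalAtlas 𝓘(ℝ, ℝ) ∞ J := IsManifold.chart_mem_maximalAtlas t
  have h1 : Subtype.val ∘ ((chartAt ℝ t).extend 𝓘(ℝ, ℝ)).symm =ᶠ[nhds s] id :=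
    Filter.eventually_of_mem (isOpen_extend_target_self.mem_nhds hs) fun r hr =>
      coe_chartAt_symm t hr
  have h2 : MDifferentiableAt 𝓘(ℝ, ℝ) 𝓘(ℝ, ℝ) (Subtype.val : J → ℝ)
      (((chartAt ℝ t).extend 𝓘(ℝ, ℝ)).symm s) :=
    (contMDiff_subtype_val (n := ∞)).contMDiffAt.mdifferentiableAt (by simp)
  have h3 := mfderiv_comp s h2 (mdifferentiableAt_extend_symm_self he hs)
  rw [h1.mfderiv_eq, mfderiv_id] at h3
  have h4 : ∀ a : ℝ, mfderiv 𝓘(ℝ, ℝ) 𝓘(ℝ, ℝ) (Subtype.val : J → ℝ)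
      (((chartAt ℝ t).extend 𝓘(ℝ, ℝ)).symm s)
        (mfderiv 𝓘(ℝ, ℝ) 𝓘(ℝ, ℝ) ((chartAt ℝ t).extend 𝓘(ℝ, ℝ)).symm s a) = a :=
    fun a => (DFunLike.congr_fun h3 a).symm
  exact ContinuousLinearMap.ext fun a => ContinuousLinearMap.ext fun b =>
    congrArg₂ (fun x y : ℝ => negDtSq s x y) (h4 a) (h4 b)

end Interval

section Product

variable {E₁ : Type*} [NormedAddCommGroup E₁] [NormedSpace ℝ E₁]
  {M₁ : Type*} [TopologicalSpace M₁] [ChartedSpace E₁ M₁]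
  {E₂ : Type*} [NormedAddCommGroup E₂] [NormedSpace ℝ E₂]
  {M₂ : Type*} [TopologicalSpace M₂] [ChartedSpace E₂ M₂]
  {e₁ : OpenPartialHomeomorph M₁ E₁} {e₂ : OpenPartialHomeomorph M₂ E₂}

/-- A product chart turns a doubly warped product into a doubly warped product. -/
theorem inChart_doublyWarped (he₁ : e₁ ∈ IsManifold.maximalAtlas 𝓘(ℝ, E₁) ∞ M₁)
    (he₂ : e₂ ∈ IsManifold.maximalAtlas 𝓘(ℝ, E₂) ∞ M₂)
    (g₁ : BilinField 𝓘(ℝ, E₁) M₁) (g₂ : BilinField 𝓘(ℝ, E₂) M₂) (f₁ : M₁ → ℝ) (f₂ : M₂ → ℝ)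
    {q : E₁ × E₂} (h₁ : q.1 ∈ (e₁.extend 𝓘(ℝ, E₁)).target)
    (h₂ : q.2 ∈ (e₂.extend 𝓘(ℝ, E₂)).target) :
    inChart (doublyWarped g₁ g₂ f₁ f₂) (e₁.prod e₂) q
      = f₂ ((e₂.extend 𝓘(ℝ, E₂)).symm q.2) ^ 2 • pullbackForm (ContinuousLinearMap.fst ℝ E₁ E₂)
          (inChart (I := 𝓘(ℝ, E₁)) g₁ e₁ q.1)
        + f₁ ((e₁.extend 𝓘(ℝ, E₁)).symm q.1) ^ 2 • pullbackForm (ContinuousLinearMap.snd ℝ E₁ E₂)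
          (inChart (I := 𝓘(ℝ, E₂)) g₂ e₂ q.2) := by
  set Ψ := ((e₁.prod e₂).extend (𝓘(ℝ, E₁).prod 𝓘(ℝ, E₂))).symm with hΨ
  have hd₁ := mdifferentiableAt_extend_symm_self he₁ h₁
  have hd₂ := mdifferentiableAt_extend_symm_self he₂ h₂
  have hf : MDifferentiableAt 𝓘(ℝ, E₁ × E₂) 𝓘(ℝ, E₁) (Prod.fst : E₁ × E₂ → E₁) q :=
    differentiableAt_fst.mdifferentiableAt
  have hs : MDifferentiableAt 𝓘(ℝ, E₁ × E₂) 𝓘(ℝ, E₂) (Prod.snd : E₁ × E₂ → E₂) q :=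
    differentiableAt_snd.mdifferentiableAt
  have hd : MDifferentiableAt 𝓘(ℝ, E₁ × E₂) (𝓘(ℝ, E₁).prod 𝓘(ℝ, E₂)) Ψ q :=
    (hd₁.comp q hf).prodMk (hd₂.comp q hs)
  have k₁ : ∀ v : E₁ × E₂, mfderiv (𝓘(ℝ, E₁).prod 𝓘(ℝ, E₂)) 𝓘(ℝ, E₁) Prod.fst (Ψ q)
      (mfderiv 𝓘(ℝ, E₁ × E₂) (𝓘(ℝ, E₁).prod 𝓘(ℝ, E₂)) Ψ q v)
      = mfderiv 𝓘(ℝ, E₁) 𝓘(ℝ, E₁) (e₁.extend 𝓘(ℝ, E₁)).symm q.1 v.1 := fun v => by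
    have h := mfderiv_comp_apply q hd₁ hf v
    rw [mfderiv_eq_fderiv, fderiv_fst] at h
    exact (mfderiv_comp_apply q mdifferentiableAt_fst hd v).symm.trans h
  have k₂ : ∀ v : E₁ × E₂, mfderiv (𝓘(ℝ, E₁).prod 𝓘(ℝ, E₂)) 𝓘(ℝ, E₂) Prod.snd (Ψ q)
      (mfderiv 𝓘(ℝ, E₁ × E₂) (𝓘(ℝ, E₁).prod 𝓘(ℝ, E₂)) Ψ q v)
      = mfderiv 𝓘(ℝ, E₂) 𝓘(ℝ, E₂) (e₂.extend 𝓘(ℝ, E₂)).symm q.2 v.2 := fun v => by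
    have h := mfderiv_comp_apply q hd₂ hs v
    rw [mfderiv_eq_fderiv, fderiv_snd] at h
    exact (mfderiv_comp_apply q mdifferentiableAt_snd hd v).symm.trans h
  refine ContinuousLinearMap.ext fun v => ContinuousLinearMap.ext fun w => ?_
  change f₂ (Ψ q).2 ^ 2 • g₁ (Ψ q).1 (mfderiv (𝓘(ℝ, E₁).prod 𝓘(ℝ, E₂)) 𝓘(ℝ, E₁) Prod.fst (Ψ q)
      (mfderiv 𝓘(ℝ, E₁ × E₂) (𝓘(ℝ, E₁).prod 𝓘(ℝ, E₂)) Ψ q v))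
      (mfderiv (𝓘(ℝ, E₁).prod 𝓘(ℝ, E₂)) 𝓘(ℝ, E₁) Prod.fst (Ψ q)
      (mfderiv 𝓘(ℝ, E₁ × E₂) (𝓘(ℝ, E₁).prod 𝓘(ℝ, E₂)) Ψ q w))
    + f₁ (Ψ q).1 ^ 2 • g₂ (Ψ q).2 (mfderiv (𝓘(ℝ, E₁).prod 𝓘(ℝ, E₂)) 𝓘(ℝ, E₂) Prod.snd (Ψ q)
      (mfderiv 𝓘(ℝ, E₁ × E₂) (𝓘(ℝ, E₁).prod 𝓘(ℝ, E₂)) Ψ q v))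
      (mfderiv (𝓘(ℝ, E₁).prod 𝓘(ℝ, E₂)) 𝓘(ℝ, E₂) Prod.snd (Ψ q)
      (mfderiv 𝓘(ℝ, E₁ × E₂) (𝓘(ℝ, E₁).prod 𝓘(ℝ, E₂)) Ψ q w)) = _
  rw [k₁, k₁, k₂, k₂]
  rfl

end Product

/-- The part of the class `𝓑` condition of the doubly warped space-time in space directions. -/
theorem covDeriv_ricci_inChart_sub_of_isClassB {E : Type*} [NormedAddCommGroup E] [NormedSpace ℝ E]
    [FiniteDimensional ℝ E]
    {M : Type*} [TopologicalSpace M] [ChartedSpace E M] [IsManifold 𝓘(ℝ, E) ∞ M]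
    (g : Bundle.ContMDiffRiemannianMetric 𝓘(ℝ, E) ∞ E (fun p : M => TangentSpace 𝓘(ℝ, E) p))
    (J : TopologicalSpace.Opens ℝ)
    (f : M → ℝ) (hf : ContMDiff 𝓘(ℝ, E) 𝓘(ℝ, ℝ) ∞ f) (hfpos : ∀ p, 0 < f p)
    (σ : ℝ → ℝ) (hσ : ContDiffOn ℝ ∞ σ J) (hσpos : ∀ t ∈ J, 0 < σ t)
    (hB : IsClassB (doublyWarped (negDtSqOn J) g.inner (fun t : J => σ t) f))
    {e : OpenPartialHomeomorph M E} (he : e ∈ IsManifold.maximalAtlas 𝓘(ℝ, E) ∞ M)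
    {y : E} (hy : y ∈ (e.extend 𝓘(ℝ, E)).target)
    {G : E → E →L[ℝ] E →L[ℝ] ℝ} (hG : G = inChart (I := 𝓘(ℝ, E)) g.inner e)
    {φ : E → ℝ} (hφ : φ = f ∘ (e.extend 𝓘(ℝ, E)).symm) {t : ℝ} (ht : t ∈ J) (w u v : E) :
    (LocalTensor.covDeriv G (LocalTensor.ricci G) y w u v
          - LocalTensor.covDeriv G (LocalTensor.ricci G) y u w v)
        - (LocalTensor.covDeriv G (LocalTensor.warpingTensor G 1 φ) y w u v
            - LocalTensor.covDeriv G (LocalTensor.warpingTensor G 1 φ) y u w v)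
        + (2 * LocalTensor.diamond negDtSq (Module.finrank ℝ E) σ t
              + ((Module.finrank ℝ E : ℝ) - 1) * deriv σ t ^ 2)
            * (1 / φ y ^ 3) * fderiv ℝ φ y w * G y u v
        - (2 * LocalTensor.diamond negDtSq (Module.finrank ℝ E) σ t
              + ((Module.finrank ℝ E : ℝ) - 1) * deriv σ t ^ 2)
            * (1 / φ y ^ 3) * fderiv ℝ φ y u * G y w v = 0 := by
  have hGm : LocalTensor.IsMetricOn G (e.extend 𝓘(ℝ, E)).target := hG ▸ isMetricOn_inChart g he
  have hφm : LocalTensor.IsWarpingOn φ (e.extend 𝓘(ℝ, E)).target :=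
    hφ ▸ isWarpingOn_comp_extend_symm he hf hfpos
  have hσm : LocalTensor.IsWarpingOn σ J :=
    ⟨fun s hs => hσ.contDiffAt (J.isOpen.mem_nhds hs), fun s hs => (hσpos s hs).ne'⟩
  set c := chartAt ℝ (⟨t, ht⟩ : J) with hc
  have hcm : c ∈ IsManifold.maximalAtlas 𝓘(ℝ, ℝ) ∞ J := IsManifold.chart_mem_maximalAtlas _
  have htc : t ∈ (c.extend 𝓘(ℝ, ℝ)).target := coe_mem_chartAt_target (⟨t, ht⟩ : J)
  have hev : inChart (doublyWarped (negDtSqOn J) g.inner (fun t : J => σ t) f) (c.prod e)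
      =ᶠ[nhds (t, y)] LocalTensor.warpedMetric σ φ G := by
    refine Filter.eventually_of_mem
      ((isOpen_extend_target_self.prod isOpen_extend_target_self).mem_nhds ⟨htc, hy⟩)
      fun q hq => ?_
    rw [inChart_doublyWarped hcm he _ _ _ _ hq.1 hq.2, inChart_negDtSqOn _ hq.1,
      coe_chartAt_symm _ hq.1, hG, hφ]
    rfl
  have hmem : (t, y) ∈ ((c.prod e).extend (𝓘(ℝ, ℝ).prod 𝓘(ℝ, E))).target := by
    rw [OpenPartialHomeomorph.extend_prod]
    exact ⟨htc, hy⟩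
  have h := hB (c.prod e) (IsManifold.mem_maximalAtlas_prod hcm he) (t, y) hmem
    (0, w) (0, u) (0, v)
  rw [LocalTensor.covDeriv_ricci_congr hev] at h
  rw [← LocalTensor.covDeriv_ricci_warpedMetric_sub hGm hφm J.isOpen hσm
    (p := (t, y)) ⟨ht, hy⟩ w u v, h, sub_self]
theorem mainTheorem7 {E : Type*} [NormedAddCommGroup E] [NormedSpace ℝ E] [FiniteDimensional ℝ E]
    (n : ℕ) (hn : Module.finrank ℝ E = n)
    {M : Type*} [TopologicalSpace M] [ChartedSpace E M] [IsManifold 𝓘(ℝ, E) ∞ M]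
    (g : Bundle.ContMDiffRiemannianMetric 𝓘(ℝ, E) ∞ E (fun p : M => TangentSpace 𝓘(ℝ, E) p))
    (J : TopologicalSpace.Opens ℝ) (hJ : (J : Set ℝ).OrdConnected) (hJne : (J : Set ℝ).Nonempty)
    (f : M → ℝ) (hf : ContMDiff 𝓘(ℝ, E) 𝓘(ℝ, ℝ) ∞ f) (hfpos : ∀ p, 0 < f p)
    (σ : ℝ → ℝ) (hσ : ContDiffOn ℝ ∞ σ J) (hσpos : ∀ t ∈ J, 0 < σ t)
    (hB : IsClassB (doublyWarped (negDtSqOn J) g.inner (fun t : J => σ t) f)) :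
    IsClassB (I := 𝓘(ℝ, E)) g.inner ↔
      ∀ e ∈ IsManifold.maximalAtlas 𝓘(ℝ, E) ∞ M, ∀ y ∈ (e.extend 𝓘(ℝ, E)).target,
        ∀ (G : E → E →L[ℝ] E →L[ℝ] ℝ) (φ : E → ℝ) (F : E → E → E → ℝ),
        G = inChart (I := 𝓘(ℝ, E)) g.inner e →
        φ = f ∘ (e.extend 𝓘(ℝ, E)).symm →
        F = LocalTensor.warpingTensor G 1 φ →
        ∀ t ∈ J, ∀ w u v : E,
          LocalTensor.covDeriv G F y w u v
            = LocalTensor.covDeriv G F y u w v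
              + (2 * LocalTensor.diamond negDtSq n σ t + ((n : ℝ) - 1) * deriv σ t ^ 2)
                  * (1 / φ y ^ 3) * fderiv ℝ φ y w * G y u v
              - (2 * LocalTensor.diamond negDtSq n σ t + ((n : ℝ) - 1) * deriv σ t ^ 2)
                  * (1 / φ y ^ 3) * fderiv ℝ φ y u * G y w v := by
  subst hn
  obtain ⟨t₀, ht₀⟩ := hJne
  constructor
  · rintro hM e he y hy G φ F hG hφ rfl t ht w u v
    have h := covDeriv_ricci_inChart_sub_of_isClassB g J f hf hfpos σ hσ hσpos hB he hy hG hφ ht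
      w u v
    have h1 := hM e he y hy w u v
    rw [← hG] at h1
    linarith
  · intro hF e he y hy w u v
    have h := covDeriv_ricci_inChart_sub_of_isClassB g J f hf hfpos σ hσ hσpos hB he hy rfl rfl ht₀
      w u v
    have h1 := hF e he y hy _ _ _ rfl rfl rfl t₀ ht₀ w u v
    linarith
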